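/- Let $\mathbb{H}$ be the division algebra of Hamilton's quaternions. For a matrix $A = A_1 + A_2\mathbf{j} \in \mathrm{M}(3,\mathbb{H})$ with $A_1, A_2 \in \mathrm{M}(3,\mathbb{C})$ put $$\Phi(A) = \begin{pmatrix} A_1 & A_2 \\ -\overline{A_2} & \overline{A_1} \end{pmatrix} \in \mathrm{M}(6,\mathbb{C}), \qquad \det\nolimits_{\mathbb{H}}(A) := \det(\Phi(A)).$$ Let $\mathrm{SL}(3,\mathbb{H})$ be the group of all $g \in \mathrm{M}(3,\mathbb{H})$ with $\det_{\mathbb{H}}(g) = 1$, and let $\mathrm{PSL}(3,\mathbb{H}) := \mathrm{SL}(3,\mathbb{H})/\{\pm \mathrm{I}_3\}$. An element $g$ of a group $G$ is called reversible if it is conjugate to $g^{-1}$ in $G$, and strongly reversible if it is a product of at most two involutions of $G$, that is, $g = ab$ with $a, b \in G$ and $a^2 = b^2 = 1$ (equivalently, $hgh^{-1} = g^{-1}$ for some $h \in G$ with $h^2 = 1$). Theorem. An element of $\mathrm{PSL}(3,\mathbb{H})$ is reversible if and only if it is strongly reversible. -/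

import Mathlib

namespace QuatProj

noncomputable section

/-! ### The complex adjoint of a quaternionic matrix -/

/-- The complex number `a + b i` of a quaternion `q = a + b i + c j + d k = (a + b i) + (c + d i) j`. -/
def fstPart (q : Quaternion ℝ) : ℂ := ⟨q.re, q.imI⟩

/-- The complex number `c + d i` of a quaternion `q = a + b i + c j + d k = (a + b i) + (c + d i) j`. -/
def sndPart (q : Quaternion ℝ) : ℂ := ⟨q.imJ, q.imK⟩

theorem fstPart_mul (p q : Quaternion ℝ) :
    fstPart (p * q) = fstPart p * fstPart q - sndPart p * star (sndPart q) := by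
  apply Complex.ext <;> simp [fstPart, sndPart] <;> ring

theorem sndPart_mul (p q : Quaternion ℝ) :
    sndPart (p * q) = fstPart p * sndPart q + sndPart p * star (fstPart q) := by
  apply Complex.ext <;> simp [fstPart, sndPart] <;> ring

/-- `fstPart` as a homomorphism of additive groups. -/
def fstHom : Quaternion ℝ →+ ℂ where
  toFun := fstPart
  map_zero' := rfl
  map_add' p q := by apply Complex.ext <;> simp [fstPart]

/-- `sndPart` as a homomorphism of additive groups. -/
def sndHom : Quaternion ℝ →+ ℂ where
  toFun := sndPart
  map_zero' := rfl
  map_add' p q := by apply Complex.ext <;> simp [sndPart]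

variable {n : ℕ}

/-- The complex adjoint `Φ(A) = [[A₁, A₂], [-conj A₂, conj A₁]]` of the quaternionic matrix
`A = A₁ + A₂ j`, where `A₁` and `A₂` are complex matrices. -/
def complexAdjoint (A : Matrix (Fin n) (Fin n) (Quaternion ℝ)) :
    Matrix (Fin n ⊕ Fin n) (Fin n ⊕ Fin n) ℂ :=
  Matrix.fromBlocks (A.map fstPart) (A.map sndPart)
    (-(A.map sndPart).map star) ((A.map fstPart).map star)

/-- The quaternionic determinant `det_ℍ(A) = det(Φ(A))`. -/
def detH (A : Matrix (Fin n) (Fin n) (Quaternion ℝ)) : ℂ := (complexAdjoint A).det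

theorem complexAdjoint_one :
    complexAdjoint (1 : Matrix (Fin n) (Fin n) (Quaternion ℝ)) = 1 := by
  have h1 : fstPart 1 = 1 := rfl
  have h2 : sndPart 1 = 0 := rfl
  have h3 : fstPart 0 = 0 := fstHom.map_zero
  have h4 : sndPart 0 = 0 := sndHom.map_zero
  ext (i | i) (j | j) <;> by_cases h : i = j <;>
    simp [complexAdjoint, Matrix.one_apply, h, h1, h2, h3, h4]

theorem complexAdjoint_mul (A B : Matrix (Fin n) (Fin n) (Quaternion ℝ)) :
    complexAdjoint (A * B) = complexAdjoint A * complexAdjoint B := by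
  have e1 : (A * B).map fstPart =
      A.map fstPart * B.map fstPart - A.map sndPart * (B.map sndPart).map star := by
    ext i j
    simp only [Matrix.map_apply, Matrix.mul_apply, Matrix.sub_apply]
    rw [show fstPart (∑ k, A i k * B k j) = ∑ k, fstPart (A i k * B k j) from
      map_sum fstHom _ _, ← Finset.sum_sub_distrib]
    exact Finset.sum_congr rfl fun k _ => fstPart_mul _ _
  have e2 : (A * B).map sndPart =
      A.map fstPart * B.map sndPart + A.map sndPart * (B.map fstPart).map star := by
    ext i j
    simp only [Matrix.map_apply, Matrix.mul_apply, Matrix.add_apply]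
    rw [show sndPart (∑ k, A i k * B k j) = ∑ k, sndPart (A i k * B k j) from
      map_sum sndHom _ _, ← Finset.sum_add_distrib]
    exact Finset.sum_congr rfl fun k _ => sndPart_mul _ _
  unfold complexAdjoint
  rw [Matrix.fromBlocks_multiply, e1, e2]
  congr 1
  · simp [sub_eq_add_neg]
  · ext i j
    simp [Matrix.mul_apply, add_comm]
  · ext i j
    simp [Matrix.mul_apply, sub_eq_add_neg, add_comm]

theorem detH_one : detH (1 : Matrix (Fin n) (Fin n) (Quaternion ℝ)) = 1 := by
  rw [detH, complexAdjoint_one, Matrix.det_one]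

theorem detH_mul (A B : Matrix (Fin n) (Fin n) (Quaternion ℝ)) :
    detH (A * B) = detH A * detH B := by
  rw [detH, complexAdjoint_mul, Matrix.det_mul, detH, detH]

theorem complexAdjoint_injective :
    Function.Injective (complexAdjoint (n := n)) := by
  intro A B h
  rw [complexAdjoint, complexAdjoint, Matrix.fromBlocks_inj] at h
  obtain ⟨h1, h2, -, -⟩ := h
  ext i j
  · exact congrArg Complex.re (congrFun (congrFun h1 i) j)
  · exact congrArg Complex.im (congrFun (congrFun h1 i) j)
  · exact congrArg Complex.re (congrFun (congrFun h2 i) j)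
  · exact congrArg Complex.im (congrFun (congrFun h2 i) j)

/-- A quaternionic matrix is invertible exactly when its quaternionic determinant is not zero, so
that the group of units of the matrix ring is `GL(n, ℍ) = {g | det_ℍ(g) ≠ 0}`. -/
theorem isUnit_iff_detH_ne_zero (A : Matrix (Fin n) (Fin n) (Quaternion ℝ)) :
    IsUnit A ↔ detH A ≠ 0 := by
  constructor
  · rintro ⟨u, rfl⟩ h
    have := detH_mul (u : Matrix (Fin n) (Fin n) (Quaternion ℝ)) ↑u⁻¹
    rw [Units.mul_inv, detH_one, h, zero_mul] at this
    exact one_ne_zero this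
  · intro h
    have hu : IsUnit (complexAdjoint A) :=
      (Matrix.isUnit_iff_isUnit_det _).2 (isUnit_iff_ne_zero.2 h)
    have hinj : Function.Injective (LinearMap.mulLeft ℝ A) := by
      intro B C hBC
      apply complexAdjoint_injective
      apply hu.mul_left_cancel
      rw [← complexAdjoint_mul, ← complexAdjoint_mul]
      exact congrArg complexAdjoint hBC
    obtain ⟨B, hB⟩ := LinearMap.surjective_of_injective hinj 1
    have hB' : A * B = 1 := hB
    have hBA : B * A = 1 := by
      apply hinj
      change A * (B * A) = A * 1
      rw [← mul_assoc, hB', one_mul, mul_one]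
    exact ⟨⟨A, B, hB', hBA⟩, rfl⟩

/-! ### The groups `SL(n, ℍ)` and `PSL(n, ℍ)` -/

variable (n)

/-- `SL(n, ℍ)`, the group of the invertible quaternionic matrices of quaternionic determinant
one. -/
def SLH : Subgroup (Matrix (Fin n) (Fin n) (Quaternion ℝ))ˣ where
  carrier := {g | detH (g : Matrix (Fin n) (Fin n) (Quaternion ℝ)) = 1}
  one_mem' := detH_one
  mul_mem' {a b} ha hb := by
    simp only [Set.mem_ofPred_eq] at ha hb ⊢
    rw [Units.val_mul, detH_mul, ha, hb, one_mul]
  inv_mem' {a} ha := by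
    simp only [Set.mem_ofPred_eq] at ha ⊢
    have := detH_mul (a : Matrix (Fin n) (Fin n) (Quaternion ℝ)) ↑a⁻¹
    rw [Units.mul_inv, detH_one, ha, one_mul] at this
    exact this.symm

/-- The subgroup `{I, -I}` of `SL(n, ℍ)`. -/
def plusMinusOne : Subgroup (SLH n) where
  carrier := {g | (g : (Matrix (Fin n) (Fin n) (Quaternion ℝ))ˣ) = 1 ∨
    (g : (Matrix (Fin n) (Fin n) (Quaternion ℝ))ˣ) = -1}
  one_mem' := Or.inl rfl
  mul_mem' {a b} ha hb := by
    rcases ha with ha | ha <;> rcases hb with hb | hb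
    · left; rw [Subgroup.coe_mul, ha, hb, one_mul]
    · right; rw [Subgroup.coe_mul, ha, hb, one_mul]
    · right; rw [Subgroup.coe_mul, ha, hb, mul_one]
    · left; rw [Subgroup.coe_mul, ha, hb, neg_mul_neg, one_mul]
  inv_mem' {a} ha := by
    rcases ha with ha | ha
    · left; rw [Subgroup.coe_inv, ha, inv_one]
    · right; rw [Subgroup.coe_inv, ha, inv_neg_one]

instance plusMinusOne_normal : (plusMinusOne n).Normal where
  conj_mem a ha g := by
    rcases ha with ha | ha
    · left; simp [ha]
    · right; simp [ha]

/-- `PSL(n, ℍ) = SL(n, ℍ) / {I, -I}`. -/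
abbrev PSLH : Type := SLH n ⧸ plusMinusOne n

end

/-! ### Reversible elements of a group -/

/-- An element of a group is reversible if it is conjugate to its inverse. -/
def IsReversible {G : Type*} [Group G] (g : G) : Prop := IsConj g g⁻¹

/-- An element of a group is strongly reversible if it is a product of at most two involutions.
As the factors may be trivial, this says that it is a product of two elements of order at
most `2`. -/
def IsStronglyReversible {G : Type*} [Group G] (g : G) : Prop :=
  ∃ a b : G, a ^ 2 = 1 ∧ b ^ 2 = 1 ∧ g = a * b

/-- Equivalently, the element is conjugate to its inverse by an element of order at most `2`. -/
theorem isStronglyReversible_iff {G : Type*} [Group G] (g : G) :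
    IsStronglyReversible g ↔ ∃ h : G, h ^ 2 = 1 ∧ h * g * h⁻¹ = g⁻¹ := by
  constructor
  · rintro ⟨a, b, ha, hb, rfl⟩
    refine ⟨a, ha, ?_⟩
    have ha' : a⁻¹ = a := inv_eq_of_mul_eq_one_right (by rw [← sq, ha])
    have hb' : b⁻¹ = b := inv_eq_of_mul_eq_one_right (by rw [← sq, hb])
    rw [mul_inv_rev, hb', ← mul_assoc a a b, ← sq, ha, one_mul]
  · rintro ⟨h, hh, hg⟩
    have hh' : h⁻¹ = h := inv_eq_of_mul_eq_one_right (by rw [← sq, hh])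
    refine ⟨h, h * g, hh, ?_, by rw [← mul_assoc, ← sq, hh, one_mul]⟩
    rw [hh'] at hg
    rw [sq, ← mul_assoc, hg, inv_mul_cancel]

end QuatProj

/-!
A strongly reversible element is reversible in any group. For the converse, lift the element of
`PSL(3, ℍ)` to a matrix `g`; reversibility gives an invertible `h` with `h g h⁻¹ = ε g⁻¹`, where
`ε = ±1`, and what is needed is such an `h` with `h² = 1` or `h² = -1`. The determinant of that `h`
takes care of itself: a quaternionic matrix with square `±1` has determinant `1`
(`detH_eq_one_of_sq_eq_one`, `detH_eq_one_of_sq_eq_neg_one`).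

No Jordan form is used. The square `h²` commutes with `g`, hence so does every real polynomial `u` in
`h²`, and `u h` reverses `g` up to sign as `h` does. A finite-dimensional commutative real algebra is,
up to nilpotents, a product of copies of `ℝ` and `ℂ`, so a suitable `u` makes `e = (u h)²` an
involution (`exists_commute_of_isUnit`). If `e = ±1`, this is what is wanted. Otherwise the eigenspaces
of `e` split `ℍ³` into a line and a plane, both invariant under `g` and `u h`, with `(u h)² = 1` on one
and `(u h)² = -1` on the other, and it remains to change the sign on one of them
(`exists_sq_of_sq_eq_blockDiag12`):

* if `ε = -1`, then `g² = -1` on the line, and both signs are possible there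
  (`exists_sq_eq_neg_of_mul_mul_eq_neg`);
* if `ε = 1`, the sign `1` can always be changed to `-1`, on a line
  (`exists_sq_eq_neg_of_mul_mul_eq`) as on a plane, where an involution reversing `g` is multiplied by a
  complex structure commuting with it and with `g` (`exists_sq_eq_neg_one_commute_of_sq_eq_one`).
-/

namespace QuatProj

/-! ### Units of finite-dimensional real algebras -/

section

open Polynomial

/-- Over `ℝ` the field is `ℝ` or `ℂ`, where `s⁻²` has a fourth root because it is positive in the
first case and because all roots exist in the second. -/
theorem exists_pow_four_mul_sq_eq_one_of_field {K : Type*} [Field K] [Algebra ℝ K]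
    [Algebra.IsAlgebraic ℝ K] {s : K} (hs : s ≠ 0) : ∃ w : K, w ^ 4 * s ^ 2 = 1 := by
  rcases Real.nonempty_algEquiv_or K with ⟨⟨φ⟩⟩ | ⟨⟨φ⟩⟩
  · have hs' : φ s ≠ 0 := by simpa using hs
    refine ⟨φ.symm (√|φ s|)⁻¹, φ.injective ?_⟩
    have h1 : (√|φ s|) ^ 4 = φ s ^ 2 := by
      rw [show 4 = 2 * 2 from rfl, pow_mul, Real.sq_sqrt (abs_nonneg _), sq_abs]
    simp only [map_mul, map_pow, AlgEquiv.apply_symm_apply, map_one, inv_pow, h1]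
    exact inv_mul_cancel₀ (pow_ne_zero _ hs')
  · have hs' : φ s ≠ 0 := by simpa using hs
    obtain ⟨z, hz⟩ := IsAlgClosed.exists_pow_nat_eq ((φ s ^ 2)⁻¹) (n := 4) (by norm_num)
    refine ⟨φ.symm z, φ.injective ?_⟩
    simp only [map_mul, map_pow, AlgEquiv.apply_symm_apply, map_one, hz]
    exact inv_mul_cancel₀ (pow_ne_zero _ hs')

/-- Modulo its nilradical the algebra is a product of fields, where the equation is solved factor by
factor; Newton's method lifts the solution along the nilradical. -/
theorem exists_pow_four_mul_sq_eq_one {A : Type*} [CommRing A] [Algebra ℝ A] [Module.Finite ℝ A]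
    {s : A} (hs : IsUnit s) : ∃ u : A, u ^ 4 * s ^ 2 = 1 := by
  have : IsArtinianRing A := IsArtinianRing.of_finite ℝ A
  have hfield (m : MaximalSpectrum A) :
      ∃ w : A ⧸ m.asIdeal, w ^ 4 * (Ideal.Quotient.mk m.asIdeal s) ^ 2 = 1 := by
    let := Ideal.Quotient.field m.asIdeal
    exact exists_pow_four_mul_sq_eq_one_of_field (hs.map (Ideal.Quotient.mk m.asIdeal)).ne_zero
  choose w hw using hfield
  obtain ⟨x, hx⟩ := Ideal.Quotient.mk_surjective ((IsArtinianRing.quotNilradicalEquivPi A).symm w)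
  have hx' (m : MaximalSpectrum A) : Ideal.Quotient.mk m.asIdeal x = w m := by
    rw [← (IsArtinianRing.quotNilradicalEquivPi A).apply_symm_apply w, ← hx]
    rfl
  have hnil : IsNilpotent (x ^ 4 * s ^ 2 - 1) := by
    rw [← mem_nilradical, ← Ideal.Quotient.eq_zero_iff_mem]
    apply (IsArtinianRing.quotNilradicalEquivPi A).injective
    funext m
    rw [map_zero]
    change Ideal.Quotient.mk m.asIdeal (x ^ 4 * s ^ 2 - 1) = 0
    rw [map_sub, map_mul, map_pow, map_pow, hx', hw, map_one, sub_self]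
  have hunit : IsUnit (x ^ 4 * s ^ 2) := by
    have := hnil.isUnit_one_add
    rwa [add_sub_cancel] at this
  have hx_unit : IsUnit x := by
    rw [IsUnit.mul_iff, isUnit_pow_iff (by norm_num)] at hunit
    exact hunit.1
  have h4 : IsUnit (4 : A) := by
    have := (isUnit_iff_ne_zero.2 (by norm_num : (4 : ℝ) ≠ 0)).map (algebraMap ℝ A)
    rwa [map_ofNat] at this
  obtain ⟨r, ⟨-, hr⟩, -⟩ := existsUnique_nilpotent_sub_and_aeval_eq_zero (R := A) (S := A)
    (P := C (s ^ 2) * X ^ 4 - 1) (x := x) (by simpa [mul_comm] using hnil) (by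
      have : IsUnit (4 * x ^ 3 * s ^ 2) := (h4.mul (hx_unit.pow 3)).mul (hs.pow 2)
      have hd : derivative (C (s ^ 2) * X ^ 4 - 1 : A[X]) = C (4 * s ^ 2) * X ^ 3 := by
        rw [derivative_sub, derivative_C_mul, derivative_X_pow, derivative_one, map_mul]
        simp only [Nat.cast_ofNat, C_ofNat]
        ring
      rw [hd]
      simpa [mul_right_comm] using this)
  exact ⟨r, sub_eq_zero.1 (by simpa [mul_comm] using hr)⟩

/-- Every unit `s` of a finite-dimensional real algebra becomes an involution after multiplication
by the square of an element `u` of the real subalgebra generated by `s`. Of that subalgebra only the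
commutation of `u` with the centralizer of `s` is recorded. -/
theorem exists_commute_of_isUnit {M : Type*} [Ring M] [Algebra ℝ M] [Module.Finite ℝ M]
    {s : M} (hs : IsUnit s) :
    ∃ u : M, (u ^ 2 * s) ^ 2 = 1 ∧ ∀ x, Commute s x → Commute u x := by
  set f := minpoly ℝ s with hf
  have hint : IsIntegral ℝ s := Algebra.IsIntegral.isIntegral s
  have hmonic : f.Monic := minpoly.monic hint
  have : Module.Finite ℝ (AdjoinRoot f) := hmonic.finite_adjoinRoot
  -- As `s` is a unit, the root of `f = minpoly ℝ s` is a unit of `ℝ[X] / (f)`.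
  have hcop : IsCoprime X f := by
    refine (irreducible_X.coprime_iff_not_dvd).2 ?_
    rintro ⟨q, hq⟩
    have hq0 : q ≠ 0 := by
      rintro rfl
      exact hmonic.ne_zero (by rw [hq, mul_zero])
    have hqs : aeval s q = 0 := by
      have : s * aeval s q = 0 := by
        have := minpoly.aeval ℝ s
        rwa [← hf, hq, map_mul, aeval_X] at this
      exact hs.mul_right_eq_zero.1 this
    have hle := natDegree_le_of_dvd (minpoly.dvd ℝ s hqs) hq0
    rw [← hf, hq, natDegree_X_mul hq0] at hle
    omega
  have hroot : IsUnit (AdjoinRoot.mk f X) := by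
    obtain ⟨a, b, hab⟩ := hcop
    refine IsUnit.of_mul_eq_one (AdjoinRoot.mk f a) ?_
    have := congrArg (AdjoinRoot.mk f) hab
    rw [map_add, map_mul, map_mul, AdjoinRoot.mk_self, mul_zero, add_zero, map_one] at this
    rw [mul_comm, this]
  obtain ⟨u, hu⟩ := exists_pow_four_mul_sq_eq_one hroot
  obtain ⟨p, rfl⟩ := AdjoinRoot.mk_surjective u
  rw [← map_pow, ← map_pow, ← map_mul, ← map_one (AdjoinRoot.mk f), AdjoinRoot.mk_eq_mk] at hu
  obtain ⟨c, hc⟩ := hu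
  have hc' : (aeval s p) ^ 4 * s ^ 2 - 1 = 0 := by
    have := congrArg (aeval s) hc
    rwa [map_mul, hf, minpoly.aeval, zero_mul, map_sub, map_mul, map_pow, map_pow, aeval_X,
      map_one] at this
  have hcomm (x : M) (hx : Commute s x) : Commute (aeval s p) x := by
    have hle : Algebra.adjoin ℝ {s} ≤ Subalgebra.centralizer ℝ {x} :=
      Algebra.adjoin_le (Set.singleton_subset_iff.2
        (Subalgebra.mem_centralizer_iff ℝ |>.2 fun y hy => by rw [Set.mem_singleton_iff.1 hy, hx.eq]))
    exact ((Subalgebra.mem_centralizer_iff ℝ).1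
      (hle (aeval_mem_adjoin_singleton ℝ s)) x rfl).symm
  refine ⟨aeval s p, ?_, hcomm⟩
  have := hcomm s (Commute.refl s)
  rw [(this.pow_left 2).mul_pow, ← pow_mul]
  exact sub_eq_zero.1 hc'

end

section

open Matrix

/-! ### Diagonalization of involutive matrices -/

/-- An involutive matrix is conjugate to a diagonal one: the row vectors `v` with `v e = ±v` span, so
they contain a basis, whose members are the rows of `P`. Row vectors are used since they form a
space over `D` on which matrices act linearly from the right. -/
theorem exists_conj_eq_diagonal {D : Type*} [DivisionRing D] [CharZero D] {n : ℕ}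
    {e : Matrix (Fin n) (Fin n) D} (he : e ^ 2 = 1) :
    ∃ (P : (Matrix (Fin n) (Fin n) D)ˣ) (d : Fin n → D),
      (∀ i, d i = 1 ∨ d i = -1) ∧ P * e = diagonal d * P := by
  set s : Set (Fin n → D) := {v | v ᵥ* e = v ∨ v ᵥ* e = -v} with hs
  have hspan : ⊤ ≤ Submodule.span D s := by
    intro v _
    have hv : v = (2⁻¹ : D) • (v + v ᵥ* e) + (2⁻¹ : D) • (v - v ᵥ* e) := by
      rw [← smul_add, add_add_sub_cancel, ← two_smul D, smul_smul, inv_mul_cancel₀ two_ne_zero,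
        one_smul]
    have hee : (v ᵥ* e) ᵥ* e = v := by rw [vecMul_vecMul, ← sq, he, vecMul_one]
    rw [hv]
    refine add_mem (Submodule.smul_mem _ _ (Submodule.subset_span (Or.inl ?_)))
      (Submodule.smul_mem _ _ (Submodule.subset_span (Or.inr ?_)))
    · rw [add_vecMul, hee, add_comm]
    · rw [sub_vecMul, hee, neg_sub]
  let b₀ := Module.Basis.ofSpan hspan
  have : Fintype ((linearIndepOn_empty D (id : (Fin n → D) → _)).extend (Set.empty_subset s)) :=
    FiniteDimensional.fintypeBasisIndex b₀
  let b := b₀.reindex (Fintype.equivFinOfCardEq (by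
    rw [← Module.finrank_eq_card_basis b₀, Module.finrank_fin_fun]))
  have hb (i) : b i ∈ s := by
    apply Module.Basis.ofSpan_subset hspan
    rw [Module.Basis.reindex_apply]
    exact Set.mem_range_self _
  set P : Matrix (Fin n) (Fin n) D := Matrix.of b with hP
  have hsurj : Function.Surjective fun v => v ᵥ* P := by
    intro v
    refine ⟨b.repr v, ?_⟩
    conv_rhs => rw [← b.sum_repr v]
    ext j
    simp [vecMul, dotProduct, hP]
  obtain ⟨Q, hQ⟩ := vecMul_surjective_iff_exists_left_inverse.1 hsurj
  have hd (i) : ∃ d : D, (d = 1 ∨ d = -1) ∧ b i ᵥ* e = d • b i := by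
    rcases hb i with h | h
    · exact ⟨1, Or.inl rfl, by rw [h, one_smul]⟩
    · exact ⟨-1, Or.inr rfl, by rw [h, neg_one_smul]⟩
  choose d hd1 hd2 using hd
  refine ⟨⟨P, Q, mul_eq_one_comm.1 hQ, hQ⟩, d, hd1, ?_⟩
  ext i j
  change (b i ᵥ* e) j = (diagonal d * P) i j
  rw [hd2, diagonal_mul]
  rfl

/-- Every involutive matrix over a division ring of characteristic zero is taken by an automorphism
of the matrix ring to a diagonal matrix with entries `1` and `-1`. -/
theorem exists_ringEquiv_eq_diagonal {D : Type*} [DivisionRing D] [CharZero D] {n : ℕ}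
    {e : Matrix (Fin n) (Fin n) D} (he : e ^ 2 = 1) :
    ∃ (φ : Matrix (Fin n) (Fin n) D ≃+* Matrix (Fin n) (Fin n) D) (d : Fin n → D),
      (∀ i, d i = 1 ∨ d i = -1) ∧ φ e = diagonal d := by
  obtain ⟨P, d, hd, hP⟩ := exists_conj_eq_diagonal he
  refine ⟨MulSemiringAction.toRingEquiv (ConjAct (Matrix (Fin n) (Fin n) D)ˣ) _
    (ConjAct.toConjAct P), d, hd, ?_⟩
  rw [MulSemiringAction.toRingEquiv_apply_apply, ConjAct.units_smul_def, ConjAct.ofConjAct_toConjAct, hP,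
    Units.mul_inv_cancel_right]

/-! ### Quaternionic determinants of square roots of `1` and `-1` -/

instance charZero_quaternion : CharZero (Quaternion ℝ) :=
  charZero_of_injective_algebraMap (algebraMap ℝ (Quaternion ℝ)).injective

/-- The quaternionic determinant is real, since `Φ(A)` is similar to its complex conjugate. -/
theorem star_detH {n : ℕ} (A : Matrix (Fin n) (Fin n) (Quaternion ℝ)) : star (detH A) = detH A := by
  set J : Matrix (Fin n ⊕ Fin n) (Fin n ⊕ Fin n) ℂ := fromBlocks 0 1 (-1) 0 with hJ
  have hJJ : J * J = -1 := by
    rw [hJ, fromBlocks_multiply, ← fromBlocks_one, fromBlocks_neg]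
    simp
  have hJu : J.det ≠ 0 := by
    intro h
    have : (J * -J).det = 0 := by rw [det_mul, h, zero_mul]
    rw [mul_neg, hJJ, neg_neg, det_one] at this
    exact one_ne_zero this
  have hcomm : J * complexAdjoint A = (complexAdjoint A).map star * J := by
    rw [hJ, complexAdjoint, fromBlocks_map, fromBlocks_multiply, fromBlocks_multiply]
    congr 1 <;> ext i j <;> simp [Matrix.map_apply]
  have hdet := congrArg Matrix.det hcomm
  rw [det_mul, det_mul, mul_comm] at hdet
  have h2 := mul_right_cancel₀ hJu hdet
  exact (RingHom.map_det (starRingEnd ℂ) _).trans h2.symm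

theorem detH_diagonal_eq_one {n : ℕ} {d : Fin n → Quaternion ℝ} (hd : ∀ i, d i = 1 ∨ d i = -1) :
    detH (diagonal d) = 1 := by
  have h1 (i) : fstPart (d i) ^ 2 = 1 := by
    rcases hd i with h | h <;> rw [h]
    · rw [show fstPart 1 = 1 from rfl, one_pow]
    · rw [show fstPart (-1) = -fstPart 1 from map_neg fstHom 1, neg_sq,
        show fstPart 1 = 1 from rfl, one_pow]
  have h2 (i) : sndPart (d i) = 0 := by
    rcases hd i with h | h <;> rw [h]
    · rfl
    · rw [show sndPart (-1) = -sndPart 1 from map_neg sndHom 1, show sndPart 1 = 0 from rfl,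
        neg_zero]
  have h3 (i) : star (fstPart (d i)) = fstPart (d i) := by
    rcases hd i with h | h <;> rw [h]
    · rw [show fstPart 1 = 1 from rfl, star_one]
    · rw [show fstPart (-1) = -fstPart 1 from map_neg fstHom 1,
        show fstPart 1 = 1 from rfl, star_neg, star_one]
  have e1 : (diagonal d).map fstPart = diagonal fun i => fstPart (d i) :=
    diagonal_map fstHom.map_zero
  have e2 : (diagonal d).map sndPart = 0 := by
    ext i j
    rw [map_apply, diagonal_apply]
    split_ifs
    · exact h2 i
    · rfl
  rw [detH, complexAdjoint, e1, e2, det_fromBlocks_zero₁₂, diagonal_map (star_zero _)]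
  simp only [h3, det_diagonal]
  rw [← Finset.prod_mul_distrib]
  exact Finset.prod_eq_one fun i _ => by rw [← sq, h1]

theorem detH_eq_one_of_sq_eq_one {n : ℕ} {h : Matrix (Fin n) (Fin n) (Quaternion ℝ)}
    (hh : h ^ 2 = 1) : detH h = 1 := by
  obtain ⟨P, d, hd, hP⟩ := exists_conj_eq_diagonal hh
  have := congrArg detH hP
  rw [detH_mul, detH_mul, detH_diagonal_eq_one hd, one_mul] at this
  exact (mul_eq_left₀ ((isUnit_iff_detH_ne_zero _).1 P.isUnit)).1 this

/-- The determinant is a square root of `1`. It is also a positive real number, by the identity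
`(1 + h)² = 2 h` and because quaternionic determinants are real. -/
theorem detH_eq_one_of_sq_eq_neg_one {n : ℕ} {h : Matrix (Fin n) (Fin n) (Quaternion ℝ)}
    (hh : h ^ 2 = -1) : detH h = 1 := by
  have hsq : detH h ^ 2 = 1 := by
    rw [sq, ← detH_mul, ← sq, hh]
    exact detH_eq_one_of_sq_eq_one (by rw [neg_sq, one_pow])
  rcases mul_self_eq_one_iff.1 ((sq _).symm.trans hsq) with h1 | h1
  · exact h1
  exfalso
  -- The factor `2` is written as the square of a scalar, so that its determinant is a square too.
  set c : Matrix (Fin n) (Fin n) (Quaternion ℝ) := algebraMap ℝ _ √2 with hc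
  have hcu : IsUnit c :=
    (isUnit_iff_ne_zero.2 (Real.sqrt_ne_zero'.2 two_pos)).map (algebraMap ℝ _)
  have hc2 : c ^ 2 = 2 := by
    rw [hc, ← map_pow, Real.sq_sqrt zero_le_two, map_ofNat]
  have key : (1 + h) * (1 + h) = c * c * h := by
    rw [← sq c, hc2, two_mul, mul_add, add_mul, add_mul, ← sq h, hh]
    noncomm_ring
  have hdet := congrArg detH key
  rw [detH_mul, detH_mul, detH_mul, h1] at hdet
  obtain ⟨x, hx⟩ := Complex.conj_eq_iff_real.1 (star_detH (1 + h))
  obtain ⟨y, hy⟩ := Complex.conj_eq_iff_real.1 (star_detH c)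
  have hy0 : y ≠ 0 := by
    rintro rfl
    exact (isUnit_iff_detH_ne_zero c).1 hcu (by simpa using hy)
  rw [hx, hy] at hdet
  have hxy : x * x = y * y * -1 := by exact_mod_cast hdet
  nlinarith [mul_self_nonneg x, mul_self_pos.2 hy0]

/-! ### Quaternions and quaternionic `2 × 2` matrices -/

theorem exists_quaternion_sq_eq_neg_one_commute (a : Quaternion ℝ) :
    ∃ x : Quaternion ℝ, x ^ 2 = -1 ∧ Commute x a := by
  by_cases h : a.im = 0
  · refine ⟨⟨0, 1, 0, 0⟩, ?_, ?_⟩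
    · have : (⟨0, 1, 0, 0⟩ : Quaternion ℝ) * ⟨0, 1, 0, 0⟩ = -1 := by ext <;> simp
      exact (sq _).trans this
    · have : a = (a.re : Quaternion ℝ) := by
        rw [← add_zero (a.re : Quaternion ℝ), ← h, Quaternion.re_add_im]
      rw [this]
      exact (Quaternion.coe_commutes a.re _).symm
  · have hn : ‖a.im‖ ≠ 0 := norm_ne_zero_iff.2 h
    refine ⟨‖a.im‖⁻¹ • a.im, ?_, ?_⟩
    · rw [sq, smul_mul_smul_comm, ← sq a.im, Quaternion.im_sq, Quaternion.normSq_eq_norm_mul_self,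
        smul_neg, Quaternion.smul_coe, mul_mul_mul_comm, inv_mul_cancel₀ hn, one_mul,
        Quaternion.coe_one]
    · refine Commute.smul_left ?_ _
      conv_rhs => rw [← Quaternion.re_add_im a]
      exact Commute.add_right (Quaternion.coe_commutes a.re _).symm (Commute.refl _)

/-- The relations say that `diag(1, -1) * !![a, b; c, d]` is an involution. The conclusion is that
some diagonal matrix `diag(x, y)` of square `-1` commutes with `!![a, b; c, d]`. -/
theorem exists_diagonal_commute {a b c d : Quaternion ℝ} (hab : a * b = b * d) (hca : c * a = d * c)
    (ha : a * a = 1 + b * c) (hd : d * d = 1 + c * b) :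
    ∃ x y : Quaternion ℝ, x ^ 2 = -1 ∧ y ^ 2 = -1 ∧
      x * a = a * x ∧ x * b = b * y ∧ y * c = c * x ∧ y * d = d * y := by
  by_cases hb : b = 0
  · by_cases hc : c = 0
    · subst hb hc
      obtain ⟨x, hx, -⟩ := exists_quaternion_sq_eq_neg_one_commute 0
      have hcomm {z : Quaternion ℝ} (hz : z * z = 1) : x * z = z * x := by
        rcases mul_self_eq_one_iff.1 hz with rfl | rfl <;> simp
      exact ⟨x, x, hx, hx, hcomm (by simpa using ha), by simp, by simp, hcomm (by simpa using hd)⟩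
    · subst hb
      obtain ⟨y, hy, hyd⟩ := exists_quaternion_sq_eq_neg_one_commute d
      refine ⟨c⁻¹ * y * c, y, ?_, hy, ?_, by simp, by simp [mul_assoc, hc], hyd⟩
      · have : (c⁻¹ * y * c) ^ 2 = c⁻¹ * y ^ 2 * c := by
          simp [sq, mul_assoc, hc]
        rw [this, hy]
        simp [hc]
      · have : a = c⁻¹ * d * c := by
          rw [mul_assoc, ← hca, inv_mul_cancel_left₀ hc]
        rw [this]
        have e := hyd.eq
        simp only [mul_assoc, mul_inv_cancel_left₀ hc]
        rw [← mul_assoc y, e, mul_assoc]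
  -- For `b ≠ 0`, conjugation by `b` turns `a` into `d`, and `b * c` is a polynomial in `a`.
  · obtain ⟨x, hx, hxa⟩ := exists_quaternion_sq_eq_neg_one_commute a
    refine ⟨x, b⁻¹ * x * b, hx, ?_, hxa, by simp [mul_assoc, hb], ?_, ?_⟩
    · have : (b⁻¹ * x * b) ^ 2 = b⁻¹ * x ^ 2 * b := by
        simp [sq, mul_assoc, hb]
      rw [this, hx]
      simp [hb]
    · have : c = b⁻¹ * (a * a - 1) := by
        rw [ha, add_sub_cancel_left, inv_mul_cancel_left₀ hb]
      rw [this]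
      have e : Commute x (a * a - 1) := (hxa.mul_right hxa).sub_right (Commute.one_right x)
      simp only [mul_assoc, mul_inv_cancel_left₀ hb]
      rw [e.eq]
    · have : d = b⁻¹ * a * b := by
        rw [mul_assoc, hab, inv_mul_cancel_left₀ hb]
      rw [this]
      have e := hxa.eq
      simp only [mul_assoc, mul_inv_cancel_left₀ hb]
      rw [← mul_assoc x, e, mul_assoc]

/-- If `K` and `K * G` are involutions of `ℍ²`, then some complex structure commutes with both. One
diagonalizes `K`, and `G` as well when `K = ±1`. -/
theorem exists_sq_eq_neg_one_commute_of_sq_eq_one {G K : Matrix (Fin 2) (Fin 2) (Quaternion ℝ)}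
    (hK : K ^ 2 = 1) (hKG : (K * G) ^ 2 = 1) :
    ∃ L : Matrix (Fin 2) (Fin 2) (Quaternion ℝ), L ^ 2 = -1 ∧ Commute L K ∧ Commute L G := by
  obtain ⟨φ, k, hk, hφ⟩ := exists_ringEquiv_eq_diagonal hK
  by_cases hconst : k 0 = k 1
  · have hK1 : K = 1 ∨ K = -1 := by
      rcases hk 0 with h | h
      · left
        apply φ.injective
        rw [hφ, map_one, ← diagonal_one]
        congr 1
        ext1 i
        fin_cases i
        exacts [h, hconst ▸ h]
      · right
        apply φ.injective
        rw [hφ, map_neg, map_one, ← diagonal_one, diagonal_neg]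
        congr 1
        ext1 i
        fin_cases i
        exacts [h, hconst ▸ h]
    have hG : G ^ 2 = 1 := by
      rcases hK1 with rfl | rfl <;> simpa using hKG
    obtain ⟨ψ, d, hd, hψ⟩ := exists_ringEquiv_eq_diagonal hG
    obtain ⟨x, hx, -⟩ := exists_quaternion_sq_eq_neg_one_commute 0
    refine ⟨ψ.symm (diagonal fun _ => x), ?_, ?_, ?_⟩
    · rw [← map_pow, diagonal_pow, ← map_one ψ.symm, ← map_neg, ← diagonal_one, diagonal_neg]
      congr 2
      ext1 i
      exact hx
    · rcases hK1 with rfl | rfl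
      exacts [Commute.one_right _, Commute.neg_one_right _]
    · rw [← ψ.symm_apply_apply G]
      refine Commute.map ?_ ψ.symm
      rw [hψ]
      change diagonal _ * diagonal _ = diagonal _ * diagonal _
      rw [diagonal_mul_diagonal, diagonal_mul_diagonal]
      congr 1
      ext1 i
      rcases hd i with h | h <;> simp [h]
  · set a := φ G 0 0
    set b := φ G 0 1
    set c := φ G 1 0
    set d := φ G 1 1
    have hG : φ G = !![a, b; c, d] := Matrix.eta_fin_two _
    have hrel : (diagonal k * φ G) * (diagonal k * φ G) = 1 := by
      rw [← hφ, ← map_mul, ← map_mul, ← sq, hKG, map_one]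
    have hkd : diagonal k = !![k 0, 0; 0, k 1] := Matrix.eta_fin_two _
    rw [hkd, hG, Matrix.mul_fin_two, Matrix.mul_fin_two, Matrix.one_fin_two] at hrel
    have hk' : (k 0 = 1 ∧ k 1 = -1) ∨ (k 0 = -1 ∧ k 1 = 1) := by
      rcases hk 0 with h | h <;> rcases hk 1 with h' | h' <;> simp_all
    obtain ⟨e1, e2, e3, e4⟩ : a * a + -(b * c) = 1 ∧ a * b + -(b * d) = 0 ∧
        -(c * a) + d * c = 0 ∧ -(c * b) + d * d = 1 := by
      have e00 := congrFun (congrFun hrel 0) 0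
      have e01 := congrFun (congrFun hrel 0) 1
      have e10 := congrFun (congrFun hrel 1) 0
      have e11 := congrFun (congrFun hrel 1) 1
      rcases hk' with ⟨h, h'⟩ | ⟨h, h'⟩ <;>
        exact ⟨by simpa [h, h'] using e00, by simpa [h, h'] using e01, by simpa [h, h'] using e10,
          by simpa [h, h'] using e11⟩
    obtain ⟨x, y, hx, hy, h1, h2, h3, h4⟩ := exists_diagonal_commute (add_neg_eq_zero.1 e2)
      (neg_add_eq_zero.1 e3) (add_neg_eq_iff_eq_add.1 e1)
      ((neg_add_eq_iff_eq_add.1 e4).trans (add_comm _ _))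
    refine ⟨φ.symm !![x, 0; 0, y], ?_, ?_, ?_⟩
    · rw [← map_pow, ← map_one φ.symm, ← map_neg, sq, Matrix.mul_fin_two, Matrix.one_fin_two]
      simp [← sq, hx, hy]
    · rw [← φ.symm_apply_apply K]
      refine Commute.map ?_ φ.symm
      rw [hφ, hkd]
      change _ * _ = _ * _
      rw [Matrix.mul_fin_two, Matrix.mul_fin_two]
      rcases hk 0 with h | h <;> rcases hk 1 with h' | h' <;> simp [h, h']
    · rw [← φ.symm_apply_apply G]
      refine Commute.map ?_ φ.symm
      rw [hG]
      change _ * _ = _ * _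
      rw [Matrix.mul_fin_two, Matrix.mul_fin_two]
      simp [h1, h2, h3, h4]

/-- Here `a` has norm `1`, so that its conjugate by `b` is `-a⁻¹ = -star a`. Conjugate quaternions have
the same real part, and so `a` is purely imaginary. -/
theorem sq_eq_neg_one_of_mul_mul_eq_neg {a b : Quaternion ℝ} (hb : b ^ 2 = -1)
    (h : a * b * a = -b) : a ^ 2 = -1 := by
  have hb0 : b ≠ 0 := by
    rintro rfl
    simp at hb
  have hn : Quaternion.normSq a = 1 := by
    have := congrArg Quaternion.normSq h
    rw [map_mul, map_mul, Quaternion.normSq_neg, mul_right_comm] at this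
    have h1 := (mul_eq_right₀ (Quaternion.normSq_ne_zero.2 hb0)).1 this
    nlinarith [Quaternion.normSq_nonneg (a := a)]
  have hinv : b * a * b = star a := by
    have h1 : b * a * b * a = 1 := by
      rw [mul_assoc b a b, mul_assoc, h, mul_neg, ← sq, hb, neg_neg]
    have h2 : a * star a = 1 := by
      rw [Quaternion.self_mul_star, hn, Quaternion.coe_one]
    exact left_inv_eq_right_inv h1 h2
  have hre : a.re = 0 := by
    have h1 : (b * a * b).re = (b ^ 2 * a).re := by
      simp [sq]
      ring
    rw [hinv, hb] at h1
    simp at h1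
    linarith
  rw [Quaternion.sq_eq_neg_normSq.2 hre, hn, Quaternion.coe_one]

/-! ### Changing the sign of the square on a line -/

/-- In `ℍ`, an involution reversing `a` can be replaced by a square root of `-1` that reverses `a`. The
other exchange fails, for instance for `a = i`, which no involution reverses. -/
theorem exists_sq_eq_neg_of_mul_mul_eq {a b : Quaternion ℝ} (hb : b ^ 2 = 1)
    (h : a * b * a = b) : ∃ b' : Quaternion ℝ, b' ^ 2 = -1 ∧ a * b' * a = b' := by
  obtain ⟨x, hx, hxa⟩ := exists_quaternion_sq_eq_neg_one_commute a
  refine ⟨x, hx, ?_⟩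
  have ha : a * a = 1 := by
    rcases mul_self_eq_one_iff.1 ((sq b).symm.trans hb) with rfl | rfl <;> simpa using h
  rw [← hxa.eq, mul_assoc, ha, mul_one]

/-- In `ℍ`, an element `b` of square `±1` that conjugates `a` to `-a⁻¹` can be replaced by one whose
square has the other sign, as `a² = -1` in both cases. -/
theorem exists_sq_eq_neg_of_mul_mul_eq_neg {a b : Quaternion ℝ}
    (h : a * b * a = -b) :
    (b ^ 2 = 1 → ∃ b' : Quaternion ℝ, b' ^ 2 = -1 ∧ a * b' * a = -b') ∧
    (b ^ 2 = -1 → ∃ b' : Quaternion ℝ, b' ^ 2 = 1 ∧ a * b' * a = -b') := by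
  constructor <;> intro hb
  · have ha : a * a = -1 := by
      rcases mul_self_eq_one_iff.1 ((sq b).symm.trans hb) with rfl | rfl
      · simpa using h
      · simpa [neg_eq_iff_eq_neg] using h
    exact ⟨a, by rw [sq, ha], by rw [ha, neg_one_mul]⟩
  · exact ⟨1, one_pow 2, by rw [mul_one, ← sq, sq_eq_neg_one_of_mul_mul_eq_neg hb h]⟩

/-! ### The splitting `ℍ³ = ℍ ⊕ ℍ²` -/

/-- The block diagonal matrix `diag(a, G)` acting on `ℍ ⊕ ℍ²`. The three coordinates are indexed by
`Unit ⊕ Fin 2`, so that the block matrix lemmas apply. -/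
noncomputable def blockDiag12 (a : Quaternion ℝ) (G : Matrix (Fin 2) (Fin 2) (Quaternion ℝ)) :
    Matrix (Unit ⊕ Fin 2) (Unit ⊕ Fin 2) (Quaternion ℝ) :=
  fromBlocks (of fun _ _ => a) 0 0 G

theorem blockDiag12_mul (a b : Quaternion ℝ) (G K : Matrix (Fin 2) (Fin 2) (Quaternion ℝ)) :
    blockDiag12 a G * blockDiag12 b K = blockDiag12 (a * b) (G * K) := by
  rw [blockDiag12, blockDiag12, fromBlocks_multiply]
  simp only [Matrix.mul_zero, Matrix.zero_mul, add_zero, zero_add, blockDiag12]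
  congr 1
  ext1 i j
  simp [mul_apply]

theorem blockDiag12_sq (a : Quaternion ℝ) (G : Matrix (Fin 2) (Fin 2) (Quaternion ℝ)) :
    blockDiag12 a G ^ 2 = blockDiag12 (a ^ 2) (G ^ 2) := by
  rw [sq, sq, sq, blockDiag12_mul]

theorem neg_blockDiag12 (a : Quaternion ℝ) (G : Matrix (Fin 2) (Fin 2) (Quaternion ℝ)) :
    -blockDiag12 a G = blockDiag12 (-a) (-G) := by
  rw [blockDiag12, fromBlocks_neg, neg_zero, neg_zero]
  rfl

theorem one_eq_blockDiag12 : 1 = blockDiag12 1 1 := by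
  rw [← fromBlocks_one, blockDiag12]
  congr 1

theorem blockDiag12_inj {a b : Quaternion ℝ} {G K : Matrix (Fin 2) (Fin 2) (Quaternion ℝ)} :
    blockDiag12 a G = blockDiag12 b K ↔ a = b ∧ G = K := by
  rw [blockDiag12, blockDiag12, fromBlocks_inj]
  constructor
  · rintro ⟨h, -, -, h'⟩
    exact ⟨congrFun (congrFun h ()) (), h'⟩
  · rintro ⟨rfl, rfl⟩
    simp

theorem eq_blockDiag12_of_commute {A : Matrix (Unit ⊕ Fin 2) (Unit ⊕ Fin 2) (Quaternion ℝ)}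
    (h : Commute A (blockDiag12 1 (-1))) : ∃ a G, A = blockDiag12 a G := by
  have h' : A * _ = _ * A := h
  rw [← fromBlocks_toBlocks A, blockDiag12, fromBlocks_multiply, fromBlocks_multiply,
    fromBlocks_inj] at h'
  obtain ⟨-, h12, h21, -⟩ := h'
  have key {x : Quaternion ℝ} (hx : -x = x) : x = 0 := self_eq_neg.1 hx.symm
  refine ⟨A (Sum.inl ()) (Sum.inl ()), A.toBlocks₂₂, ?_⟩
  conv_lhs => rw [← fromBlocks_toBlocks A]
  rw [blockDiag12, fromBlocks_inj]
  refine ⟨rfl, ?_, ?_, rfl⟩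
  · ext1 i j
    have := congrFun (congrFun h12 i) j
    exact key (by simpa [mul_apply] using this)
  · ext1 i j
    have := congrFun (congrFun h21 i) j
    exact key (by simpa [mul_apply] using this.symm)

/-- If `h² = ±diag(1, -1, -1)`, the signs of `h²` on the two summands can be made equal. The summand on
which `h` is altered is `ℍ`, unless `ε = 1` and `h² = diag(-1, 1, 1)`, when it is `ℍ²`. -/
theorem exists_sq_of_sq_eq_blockDiag12 {g h : Matrix (Unit ⊕ Fin 2) (Unit ⊕ Fin 2) (Quaternion ℝ)}
    {ε : ℤ} (hε : ε = 1 ∨ ε = -1)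
    (hh : h ^ 2 = blockDiag12 1 (-1) ∨ h ^ 2 = -blockDiag12 1 (-1)) (hg : g * h * g = ε • h)
    (hcomm : Commute g (h ^ 2)) :
    ∃ h' : Matrix (Unit ⊕ Fin 2) (Unit ⊕ Fin 2) (Quaternion ℝ),
      (h' ^ 2 = 1 ∨ h' ^ 2 = -1) ∧ g * h' * g = ε • h' := by
  have hcomm' {A : Matrix (Unit ⊕ Fin 2) (Unit ⊕ Fin 2) (Quaternion ℝ)} (hA : Commute A (h ^ 2)) :
      Commute A (blockDiag12 1 (-1)) := by
    rcases hh with hh | hh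
    · rwa [hh] at hA
    · rwa [hh, Commute.neg_right_iff] at hA
  obtain ⟨a, G, rfl⟩ := eq_blockDiag12_of_commute (hcomm' hcomm)
  obtain ⟨b, K, rfl⟩ := eq_blockDiag12_of_commute (hcomm' ((Commute.refl h).pow_right 2))
  clear hcomm hcomm'
  rw [neg_blockDiag12, neg_neg, blockDiag12_sq, blockDiag12_inj, blockDiag12_inj] at hh
  rw [blockDiag12_mul, blockDiag12_mul] at hg
  rcases hε with rfl | rfl
  · rw [one_zsmul, blockDiag12_inj] at hg
    rcases hh with ⟨hb, hK⟩ | ⟨hb, hK⟩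
    · obtain ⟨b', hb', hab⟩ := exists_sq_eq_neg_of_mul_mul_eq hb hg.1
      refine ⟨blockDiag12 b' K, Or.inr ?_, ?_⟩
      · rw [blockDiag12_sq, one_eq_blockDiag12, neg_blockDiag12, hb', hK]
      · rw [blockDiag12_mul, blockDiag12_mul, one_zsmul, hab, hg.2]
    · obtain ⟨L, hL, hLK, hLG⟩ := exists_sq_eq_neg_one_commute_of_sq_eq_one (G := G) hK (by
        rw [sq, mul_assoc, ← mul_assoc G, hg.2, ← sq, hK])
      refine ⟨blockDiag12 b (L * K), Or.inr ?_, ?_⟩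
      · rw [blockDiag12_sq, one_eq_blockDiag12, neg_blockDiag12, hLK.mul_pow, hL, hK, hb, mul_one]
      · rw [blockDiag12_mul, blockDiag12_mul, one_zsmul, hg.1, ← mul_assoc G, ← hLG.eq, mul_assoc,
          mul_assoc, ← mul_assoc G, hg.2]
  · rw [neg_smul, one_zsmul, neg_blockDiag12, blockDiag12_inj] at hg
    obtain ⟨h1, h2⟩ := exists_sq_eq_neg_of_mul_mul_eq_neg hg.1
    rcases hh with ⟨hb, hK⟩ | ⟨hb, hK⟩
    · obtain ⟨b', hb', hab⟩ := h1 hb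
      refine ⟨blockDiag12 b' K, Or.inr ?_, ?_⟩
      · rw [blockDiag12_sq, one_eq_blockDiag12, neg_blockDiag12, hb', hK]
      · rw [blockDiag12_mul, blockDiag12_mul, neg_smul, one_zsmul, neg_blockDiag12, hab, hg.2]
    · obtain ⟨b', hb', hab⟩ := h2 hb
      refine ⟨blockDiag12 b' K, Or.inl ?_, ?_⟩
      · rw [blockDiag12_sq, one_eq_blockDiag12, hb', hK]
      · rw [blockDiag12_mul, blockDiag12_mul, neg_smul, one_zsmul, neg_blockDiag12, hab, hg.2]

/-- A family of three signs is constant or has one odd member, which can be moved to the front. -/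
theorem exists_equiv_comp_eq {R : Type*} [Ring R] {d : Fin 3 → R} (hd : ∀ i, d i = 1 ∨ d i = -1) :
    (∀ i, d i = 1) ∨ (∀ i, d i = -1) ∨
      ∃ σ : Fin 3 ≃ Unit ⊕ Fin 2, (d ∘ σ.symm = Sum.elim (fun _ => 1) fun _ => -1) ∨
        d ∘ σ.symm = Sum.elim (fun _ => -1) fun _ => 1 := by
  have hσ (i : Fin 3) : ∃ σ : Fin 3 ≃ Unit ⊕ Fin 2, σ.symm (Sum.inl ()) = i ∧
      ∀ j, σ.symm (Sum.inr j) = i.succAbove j :=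
    ⟨(finSuccEquiv' i).trans ((Equiv.optionEquivSumPUnit _).trans (Equiv.sumComm _ _)),
      by simp, by simp⟩
  have split (i : Fin 3) : (d i = 1 → (∀ j, d (i.succAbove j) = -1) → ∃ σ : Fin 3 ≃ Unit ⊕ Fin 2,
      d ∘ σ.symm = Sum.elim (fun _ => 1) fun _ => -1) ∧
      (d i = -1 → (∀ j, d (i.succAbove j) = 1) → ∃ σ : Fin 3 ≃ Unit ⊕ Fin 2,
        d ∘ σ.symm = Sum.elim (fun _ => -1) fun _ => 1) := by
    obtain ⟨σ, h1, h2⟩ := hσ i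
    constructor <;> intro hi hj <;> refine ⟨σ, ?_⟩ <;> ext1 (u | j)
    · exact (congrArg d h1).trans hi
    · exact (congrArg d (h2 j)).trans (hj j)
    · exact (congrArg d h1).trans hi
    · exact (congrArg d (h2 j)).trans (hj j)
  rcases hd 0 with h0 | h0 <;> rcases hd 1 with h1 | h1 <;> rcases hd 2 with h2 | h2
  · exact Or.inl (Fin.forall_fin_succ.2 ⟨h0, Fin.forall_fin_two.2 ⟨h1, h2⟩⟩)
  · exact Or.inr (Or.inr (((split 2).2 h2 (Fin.forall_fin_two.2 ⟨h0, h1⟩)).imp fun _ => Or.inr))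
  · exact Or.inr (Or.inr (((split 1).2 h1 (Fin.forall_fin_two.2 ⟨h0, h2⟩)).imp fun _ => Or.inr))
  · exact Or.inr (Or.inr (((split 0).1 h0 (Fin.forall_fin_two.2 ⟨h1, h2⟩)).imp fun _ => Or.inl))
  · exact Or.inr (Or.inr (((split 0).2 h0 (Fin.forall_fin_two.2 ⟨h1, h2⟩)).imp fun _ => Or.inr))
  · exact Or.inr (Or.inr (((split 1).1 h1 (Fin.forall_fin_two.2 ⟨h0, h2⟩)).imp fun _ => Or.inl))
  · exact Or.inr (Or.inr (((split 2).1 h2 (Fin.forall_fin_two.2 ⟨h0, h1⟩)).imp fun _ => Or.inl))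
  · exact Or.inr (Or.inl (Fin.forall_fin_succ.2 ⟨h0, Fin.forall_fin_two.2 ⟨h1, h2⟩⟩))

theorem exists_ringEquiv_eq_blockDiag12 {e : Matrix (Fin 3) (Fin 3) (Quaternion ℝ)}
    (he : e ^ 2 = 1) :
    e = 1 ∨ e = -1 ∨ ∃ φ : Matrix (Fin 3) (Fin 3) (Quaternion ℝ) ≃+*
      Matrix (Unit ⊕ Fin 2) (Unit ⊕ Fin 2) (Quaternion ℝ),
        φ e = blockDiag12 1 (-1) ∨ φ e = -blockDiag12 1 (-1) := by
  obtain ⟨ψ, d, hd, hψ⟩ := exists_ringEquiv_eq_diagonal he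
  rcases exists_equiv_comp_eq hd with h | h | ⟨σ, hσ⟩
  · left
    apply ψ.injective
    rw [hψ, map_one, funext h]
    exact diagonal_one
  · right; left
    apply ψ.injective
    rw [hψ, map_neg, map_one, funext h, ← diagonal_one, diagonal_neg]
  · right; right
    refine ⟨ψ.trans (reindexAlgEquiv ℝ _ σ).toRingEquiv, ?_⟩
    have h1 : (ψ.trans (reindexAlgEquiv ℝ (Quaternion ℝ) σ).toRingEquiv) e
        = diagonal (d ∘ σ.symm) := by
      change (ψ e).submatrix σ.symm σ.symm = _
      rw [hψ, submatrix_diagonal_equiv]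
    have h2 (x y : Quaternion ℝ) : (diagonal (Sum.elim (fun _ => x) fun _ => y) :
        Matrix (Unit ⊕ Fin 2) (Unit ⊕ Fin 2) (Quaternion ℝ)) =
        blockDiag12 x (diagonal fun _ => y) := by
      ext (i | i) (j | j) <;> simp [blockDiag12, diagonal_apply]
    rw [h1, neg_blockDiag12, neg_neg, ← diagonal_one, diagonal_neg]
    rcases hσ with h | h <;> rw [h, h2]
    · exact Or.inl rfl
    · exact Or.inr rfl

/-! ### Conjugating elements of square `1` or `-1` -/

/-- If an invertible matrix `h` satisfies `h g h⁻¹ = ε g⁻¹` with `ε = ±1`, then so does a matrix with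
square `±1`. The relation is written without inverses as `g h g = ε h`. -/
theorem exists_reverser_sq_eq {g h : Matrix (Fin 3) (Fin 3) (Quaternion ℝ)} {ε : ℤ}
    (hε : ε = 1 ∨ ε = -1) (hu : IsUnit h) (hg : g * h * g = ε • h) :
    ∃ h' : Matrix (Fin 3) (Fin 3) (Quaternion ℝ),
      (h' ^ 2 = 1 ∨ h' ^ 2 = -1) ∧ g * h' * g = ε • h' := by
  have hcomm {k : Matrix (Fin 3) (Fin 3) (Quaternion ℝ)} (hk : g * k * g = ε • k) :
      Commute (k ^ 2) g := by
    have hε' : ε * ε = 1 := by rcases hε with rfl | rfl <;> rfl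
    have h1 : g * k * g * (k * g) = g * k * (g * k * g) := by simp only [mul_assoc]
    rw [hk, smul_mul_assoc, mul_smul_comm] at h1
    have h2 := congrArg (ε • ·) h1
    simp only [smul_smul, hε', one_smul] at h2
    rw [← mul_assoc, ← sq, mul_assoc, ← sq] at h2
    exact h2
  -- `u` commutes with `g` and `h`, so `u * h` satisfies the same relation, and its square is an
  -- involution.
  obtain ⟨u, hu2, huc⟩ := exists_commute_of_isUnit (hu.pow 2)
  have hug : Commute u g := huc g (hcomm hg)
  have huh : Commute u h := huc h ((Commute.refl h).pow_left 2)
  have hgk : g * (u * h) * g = ε • (u * h) := by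
    rw [← mul_assoc, ← hug.eq, mul_assoc, mul_assoc, ← mul_assoc g, hg, mul_smul_comm]
  have he : ((u * h) ^ 2) ^ 2 = 1 := by rw [huh.mul_pow, hu2]
  rcases exists_ringEquiv_eq_blockDiag12 he with h1 | h1 | ⟨φ, h1⟩
  · exact ⟨u * h, Or.inl h1, hgk⟩
  · exact ⟨u * h, Or.inr h1, hgk⟩
  · rw [map_pow] at h1
    obtain ⟨k, hk, hgk'⟩ := exists_sq_of_sq_eq_blockDiag12 (g := φ g) hε h1
      (by rw [← map_mul, ← map_mul, hgk, map_zsmul])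
      (by rw [← map_pow]; exact (hcomm hgk).symm.map φ)
    refine ⟨φ.symm k, ?_, ?_⟩
    · rw [← map_pow]
      rcases hk with hk | hk <;> rw [hk]
      · exact Or.inl (map_one _)
      · exact Or.inr (by rw [map_neg, map_one])
    · apply φ.injective
      rw [map_mul, map_mul, map_zsmul, φ.apply_symm_apply, hgk']

/-! ### Passage to `PSL(n, ℍ)` -/

theorem mk_eq_mk_iff {n : ℕ} {x y : SLH n} :
    (x : PSLH n) = (y : PSLH n) ↔
      ((x : (Matrix (Fin n) (Fin n) (Quaternion ℝ))ˣ) : Matrix (Fin n) (Fin n) (Quaternion ℝ)) =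
        (y : (Matrix (Fin n) (Fin n) (Quaternion ℝ))ˣ) ∨
      ((x : (Matrix (Fin n) (Fin n) (Quaternion ℝ))ˣ) : Matrix (Fin n) (Fin n) (Quaternion ℝ)) =
        -(y : (Matrix (Fin n) (Fin n) (Quaternion ℝ))ˣ) := by
  rw [QuotientGroup.eq]
  change ((x⁻¹ * y : SLH n) : (Matrix (Fin n) (Fin n) (Quaternion ℝ))ˣ) = 1 ∨
    ((x⁻¹ * y : SLH n) : (Matrix (Fin n) (Fin n) (Quaternion ℝ))ˣ) = -1 ↔ _
  rw [Subgroup.coe_mul, Subgroup.coe_inv, inv_mul_eq_one, inv_mul_eq_iff_eq_mul, mul_neg, mul_one,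
    Units.ext_iff, Units.ext_iff, Units.val_neg]
  exact or_congr Iff.rfl (by rw [eq_comm, neg_eq_iff_eq_neg])

/-- A matrix with square `±1` automatically has quaternionic determinant `1`. -/
theorem exists_SLH_of_sq {n : ℕ} {h : Matrix (Fin n) (Fin n) (Quaternion ℝ)}
    (hh : h ^ 2 = 1 ∨ h ^ 2 = -1) :
    ∃ x : SLH n, ((x : (Matrix (Fin n) (Fin n) (Quaternion ℝ))ˣ) : Matrix _ _ _) = h := by
  have hdet : detH h = 1 := hh.elim detH_eq_one_of_sq_eq_one detH_eq_one_of_sq_eq_neg_one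
  obtain ⟨u, rfl⟩ := (isUnit_iff_detH_ne_zero h).2 (hdet ▸ one_ne_zero)
  exact ⟨⟨u, hdet⟩, rfl⟩

end

end QuatProj

open QuatProj in
theorem theorem1p1 (g : QuatProj.PSLH 3) :
    QuatProj.IsReversible g ↔ QuatProj.IsStronglyReversible g := by
  rw [isStronglyReversible_iff, IsReversible, isConj_iff]
  refine ⟨?_, fun ⟨h, _, hg⟩ => ⟨h, hg⟩⟩
  have key (h g : PSLH 3) : h * g * h⁻¹ = g⁻¹ ↔ g * h * g = h := by
    rw [mul_inv_eq_iff_eq_mul, eq_inv_mul_iff_mul_eq, mul_assoc]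
  rintro ⟨c, hc⟩
  rw [key] at hc
  obtain ⟨A, rfl⟩ := QuotientGroup.mk_surjective g
  obtain ⟨C, rfl⟩ := QuotientGroup.mk_surjective c
  rw [← QuotientGroup.mk_mul, ← QuotientGroup.mk_mul, mk_eq_mk_iff] at hc
  obtain ⟨ε, hε, hAC⟩ : ∃ ε : ℤ, (ε = 1 ∨ ε = -1) ∧
      (A.1.1 * C.1.1 * A.1.1 : Matrix (Fin 3) (Fin 3) (Quaternion ℝ)) = ε • C.1.1 := by
    rcases hc with hc | hc
    · exact ⟨1, Or.inl rfl, by rw [one_zsmul]; exact hc⟩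
    · exact ⟨-1, Or.inr rfl, by rw [neg_smul, one_zsmul]; exact hc⟩
  obtain ⟨h, hh, hAh⟩ := exists_reverser_sq_eq hε C.1.isUnit hAC
  obtain ⟨x, rfl⟩ := exists_SLH_of_sq hh
  refine ⟨x, ?_, ?_⟩
  · rw [← QuotientGroup.mk_pow, ← QuotientGroup.mk_one, mk_eq_mk_iff]
    exact hh
  · rw [key, ← QuotientGroup.mk_mul, ← QuotientGroup.mk_mul, mk_eq_mk_iff]
    rcases hε with rfl | rfl
    · rw [one_zsmul] at hAh
      exact Or.inl hAh
    · rw [neg_smul, one_zsmul] at hAh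
      exact Or.inr hAh
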